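/- Let $m\in\{1,2,\dots\}\cup\{\infty\}$, write $\mathbb Z_m=\mathbb Z/m\mathbb Z$ for $m<\infty$ and $\mathbb Z_\infty=\mathbb Z$, and let $\mathfrak g^{\mathbb C}=\bigoplus_{i\in\mathbb Z_m}\mathfrak g_i^{\mathbb C}$ be a finite-dimensional complex $\mathbb Z_m$-graded Lie algebra which is simple as a graded Lie algebra (non-abelian, without homogeneous ideals other than $0$ and $\mathfrak g^{\mathbb C}$). Let $\theta\in\operatorname{Aut}(\mathfrak g^{\mathbb C})$ be the automorphism defining the grading: $\theta(x)=\omega^i x$ for $x\in\mathfrak g_i^{\mathbb C}$, where $\omega$ is a primitive $m$-th root of unity if $m<\infty$ and $\omega=2$ if $m=\infty$. Let $\mathfrak g$ be a real form of the Lie algebra $\mathfrak g^{\mathbb C}$, with complex conjugation $\sigma$, such that the cyclic group $\langle\theta\rangle$ is defined over $\mathbb R$, i.e. $\sigma\langle\theta\rangle\sigma^{-1}=\langle\theta\rangle$. Let $\Gamma=\operatorname{Gal}(\mathbb C/\mathbb R)=\{1,\gamma\}$ act on $\operatorname{Aut}(\mathfrak g^{\mathbb C})$ by ${}^\gamma g=\sigma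 g\sigma^{-1}$, and let $\mathcal N^*=\mathcal N^*_{\operatorname{Aut}(\mathfrak g^{\mathbb C})}(\langle\theta\rangle)$ be the ($\Gamma$-stable) subgroup of those elements $g$ of the normalizer of $\langle\theta\rangle$ for which $g\theta g^{-1}$ generates $\langle\theta\rangle$. For a $\Gamma$-group $A$ let $H^1A$ be the set of all $z\in A$ with $z\cdot{}^\gamma z=1$ modulo $z\sim c^{-1}z\,{}^\gamma c$ ($c\in A$), pointed by the class of $1$; the kernel of a map of pointed sets is the preimage of the base point. A real form of $(\mathfrak g^{\mathbb C},\theta)$ (with underlying real Lie algebra $\mathfrak g$) is a real form of $\mathfrak g^{\mathbb C}$ that is isomorphic to $\mathfrak g$ as a real Lie algebra and whose complex conjugation $\tau$ satisfies $\tau\langle\theta\rangle\tau^{-1}=\langle\theta\rangle$; two of them are isomorphic if there is an isomorphism of real Lie algebras between them whose complex linear extension lies in $\mathcal N^*$. Then: (1) $\tau\mapsto[\tau\sigma]$ induces a bijection from the set of isomorphism classes of real forms of $(\mathfrak g^{\mathbb C},\theta)$ onto $$\ker\bigl[H^1\mathcal N^*_{\operatorname{Aut}(\mathfrak g^{\mathbb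 C})}(\langle\theta\rangle)\to H^1\operatorname{Aut}(\mathfrak g^{\mathbb C})\bigr].$$ (2) Equivalently, in terms of $\mathfrak g$ itself: let $Y=\{g\langle\theta\rangle g^{-1}: g\in\operatorname{Aut}(\mathfrak g^{\mathbb C})\}$, and call $H\in Y$ a real point if $\sigma H\sigma^{-1}=H$. Then $g\langle\theta\rangle g^{-1}\mapsto[g^{-1}\cdot{}^\gamma g]$ induces a bijection from the set of $\operatorname{Aut}(\mathfrak g^{\mathbb C})^{\Gamma}$-conjugacy classes of real points of $Y$ onto the same kernel. -/

import Mathlib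

/-! ## First cohomology of a group with an action of `Gal(ℂ/ℝ)` -/

/-- An action of `Γ = Gal(ℂ/ℝ) = {1, γ}` on a group `A` by automorphisms, given by the action of the
complex conjugation `γ`, which is an involutive automorphism of `A`. -/
structure GammaAction (A : Type*) [Group A] where
  /-- the action of `γ` -/
  conj : A →* A
  conj_conj : ∀ a, conj (conj a) = a

namespace GammaAction

variable {A : Type*} [Group A]

/-- `1`-cocycles of `Γ` with values in `A`: a cocycle `c` is determined by `z = c γ`, subject to
`z * γ(z) = 1` (and `c 1 = 1`). -/
def Cocycle (s : GammaAction A) : Type _ := {z : A // z * s.conj z = 1}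

/-- Cohomologous cocycles: `w = c⁻¹ * z * γ(c)` for some `c` in `A`. -/
def cohomologous (s : GammaAction A) : Setoid s.Cocycle where
  r z w := ∃ c : A, w.1 = c⁻¹ * z.1 * s.conj c
  iseqv :=
    { refl := fun z => ⟨1, by simp⟩
      symm := by
        rintro z w ⟨c, h⟩
        exact ⟨c⁻¹, by rw [h]; simp [mul_assoc]⟩
      trans := by
        rintro z w v ⟨c, h⟩ ⟨d, k⟩
        exact ⟨c * d, by rw [k, h]; simp [mul_assoc]⟩ }

/-- The pointed set `H¹(Γ, A)`. -/
def H1 (s : GammaAction A) : Type _ := Quotient s.cohomologous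

/-- The class of a cocycle. -/
def H1.mk (s : GammaAction A) (z : s.Cocycle) : s.H1 := Quotient.mk s.cohomologous z

/-- The neutral element of `H¹`, the class of the trivial cocycle. -/
def H1.neutral (s : GammaAction A) : s.H1 := H1.mk s ⟨1, by simp⟩

/-- The induced action on a `Γ`-stable subgroup. -/
def restrict (s : GammaAction A) (B : Subgroup A) (hB : ∀ b ∈ B, s.conj b ∈ B) :
    GammaAction B where
  conj :=
    { toFun := fun b => ⟨s.conj b, hB b b.2⟩
      map_one' := by ext; simp
      map_mul' := fun a b => by ext; simp }
  conj_conj := fun b => by ext; exact s.conj_conj b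

/-- The map `H¹(Γ, B) → H¹(Γ, A)` induced by the inclusion of a `Γ`-stable subgroup `B` of `A`. -/
def H1.inclusion (s : GammaAction A) (B : Subgroup A) (hB : ∀ b ∈ B, s.conj b ∈ B) :
    (s.restrict B hB).H1 → s.H1 :=
  Quotient.map' (s₁ := (s.restrict B hB).cohomologous) (s₂ := s.cohomologous)
    (fun z => ⟨(z.1 : A), congrArg Subtype.val z.2⟩)
    (by
      rintro z w ⟨c, h⟩
      exact ⟨(c : A), congrArg Subtype.val h⟩)

/-- `ker [H¹(Γ, B) → H¹(Γ, A)]`. -/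
def H1.kernel (s : GammaAction A) (B : Subgroup A) (hB : ∀ b ∈ B, s.conj b ∈ B) :
    Set (s.restrict B hB).H1 :=
  {x | H1.inclusion s B hB x = H1.neutral s}

end GammaAction

/-! ## Automorphisms, gradings -/

/-- The automorphism group of a complex Lie algebra, under composition. -/
instance lieAutGroup {L : Type*} [LieRing L] [LieAlgebra ℂ L] : Group (L ≃ₗ⁅ℂ⁆ L) where
  mul f g := g.trans f
  one := 1
  inv f := f.symm
  mul_assoc _ _ _ := rfl
  one_mul _ := rfl
  mul_one _ := rfl
  inv_mul_cancel f := by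
    ext x
    exact f.symm_apply_apply x

/-- A `ℤ_m`-grading of a complex Lie algebra; `m = 0` stands for `m = ∞`, i.e. a `ℤ`-grading
(recall `ZMod 0 = ℤ`). -/
structure LieGrading (m : ℕ) (L : Type*) [LieRing L] [LieAlgebra ℂ L] where
  /-- the homogeneous components -/
  component : ZMod m → Submodule ℂ L
  isInternal : DirectSum.IsInternal component
  lie_mem : ∀ {i j : ZMod m} {x y : L},
    x ∈ component i → y ∈ component j → ⁅x, y⁆ ∈ component (i + j)

namespace LieGrading

variable {m : ℕ} {L : Type*} [LieRing L] [LieAlgebra ℂ L]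

/-- A graded Lie algebra is simple if it is not abelian and has no homogeneous ideals other than
`0` and itself. (In particular every grading of a simple Lie algebra is simple.) -/
def IsSimple (G : LieGrading m L) : Prop :=
  ¬ IsLieAbelian L ∧
    ∀ I : LieIdeal ℂ L,
      I.toSubmodule = ⨆ i, I.toSubmodule ⊓ G.component i → I = ⊥ ∨ I = ⊤

/-- `θ` is the automorphism defining the grading: `θ x = ω ^ i x` for `x` of degree `i`, where `ω`
is a primitive `m`-th root of unity if `m` is finite, and `ω = 2` if `m = ∞`. -/
def IsDefinedBy (G : LieGrading m L) (θ : L ≃ₗ⁅ℂ⁆ L) : Prop :=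
  ∃ ω : ℂ, (if m = 0 then ω = 2 else IsPrimitiveRoot ω m) ∧
    ∀ i : ℤ, ∀ x ∈ G.component (i : ZMod m), θ x = ω ^ i • x

end LieGrading

/-- `N*`: the elements of the normalizer of `⟨θ⟩` which conjugate `θ` to a generator of `⟨θ⟩`. -/
def starNormalizer {A : Type*} [Group A] (θ : A) : Subgroup A where
  carrier := {g | g ∈ Subgroup.normalizer (Subgroup.zpowers θ : Set A) ∧
    Subgroup.zpowers (g * θ * g⁻¹) = Subgroup.zpowers θ}
  one_mem' := ⟨Subgroup.one_mem _, by simp⟩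
  mul_mem' := by
    rintro a b ⟨ha, ha'⟩ ⟨hb, hb'⟩
    refine ⟨Subgroup.mul_mem _ ha hb, ?_⟩
    have h := congrArg (Subgroup.map (MulAut.conj a).toMonoidHom) hb'
    simp only [MonoidHom.map_zpowers] at h
    rw [← ha']
    simpa [mul_assoc] using h
  inv_mem' := by
    rintro a ⟨ha, ha'⟩
    refine ⟨Subgroup.inv_mem _ ha, ?_⟩
    have h := congrArg (Subgroup.map (MulAut.conj a⁻¹).toMonoidHom) ha'
    simp only [MonoidHom.map_zpowers] at h
    rw [eq_comm]
    simpa [mul_assoc] using h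

/-! ## Real forms -/

/-- A conjugation of a complex Lie algebra: an antilinear involution preserving the bracket. Its
fixed points are a real form of the Lie algebra, and every real form arises from exactly one
conjugation. -/
structure LieConjugation (L : Type*) [LieRing L] [LieAlgebra ℂ L] where
  /-- the underlying antilinear map -/
  toMap : L →ₛₗ[starRingEnd ℂ] L
  map_lie : ∀ x y, toMap ⁅x, y⁆ = ⁅toMap x, toMap y⁆
  involutive : ∀ x, toMap (toMap x) = x

namespace LieConjugation

variable {L : Type*} [LieRing L] [LieAlgebra ℂ L]

/-- The automorphism `x ↦ σ (g (σ x))`. -/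
def conjAut (σ : LieConjugation L) (g : L ≃ₗ⁅ℂ⁆ L) : L ≃ₗ⁅ℂ⁆ L where
  toFun x := σ.toMap (g (σ.toMap x))
  map_add' x y := by simp
  map_smul' c x := by simp [map_smulₛₗ]
  map_lie' := by
    intro x y
    rw [σ.map_lie, LieEquiv.map_lie, σ.map_lie]
  invFun x := σ.toMap (g.symm (σ.toMap x))
  left_inv x := by simp [σ.involutive]
  right_inv x := by simp [σ.involutive]

/-- The action of `Γ` on `Aut L` determined by a real form: `γ` acts by `g ↦ σ g σ⁻¹`. -/
def gammaAction (σ : LieConjugation L) : GammaAction (L ≃ₗ⁅ℂ⁆ L) where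
  conj :=
    { toFun := σ.conjAut
      map_one' := by
        ext x
        exact σ.involutive x
      map_mul' := fun g h => by
        ext x
        change σ.toMap (g (h (σ.toMap x))) =
          σ.toMap (g (σ.toMap (σ.toMap (h (σ.toMap x)))))
        rw [σ.involutive] }
  conj_conj := fun g => by
    ext x
    change σ.toMap (σ.toMap (g (σ.toMap (σ.toMap x)))) = g x
    rw [σ.involutive, σ.involutive]

/-- The subgroup `H` of `Aut L` is defined over `ℝ`, i.e. preserved by the conjugation. -/
def Preserves (σ : LieConjugation L) (H : Subgroup (L ≃ₗ⁅ℂ⁆ L)) : Prop :=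
  H.map σ.gammaAction.conj = H

/-- If `⟨θ⟩` is defined over `ℝ` then so is `N*`. -/
theorem starNormalizer_stable (σ : LieConjugation L) {θ : L ≃ₗ⁅ℂ⁆ L}
    (h : σ.Preserves (Subgroup.zpowers θ)) :
    ∀ b ∈ starNormalizer θ, σ.gammaAction.conj b ∈ starNormalizer θ := by
  rintro b ⟨hb, hb'⟩
  have key : (Subgroup.zpowers θ).map (MulAut.conj (σ.gammaAction.conj b)).toMonoidHom =
      Subgroup.zpowers θ := by
    have e : (MulAut.conj (σ.gammaAction.conj b)).toMonoidHom.comp σ.gammaAction.conj =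
        σ.gammaAction.conj.comp (MulAut.conj b).toMonoidHom := by
      ext1 g
      simp
    have hb'' : (Subgroup.zpowers θ).map (MulAut.conj b).toMonoidHom = Subgroup.zpowers θ := by
      rw [MonoidHom.map_zpowers]
      simpa using hb'
    conv_lhs => rw [← h]
    rw [Subgroup.map_map, e, ← Subgroup.map_map, hb'', h]
  refine ⟨?_, ?_⟩
  · rw [Subgroup.mem_normalizer_iff]
    intro x
    constructor
    · intro hx
      have : (MulAut.conj (σ.gammaAction.conj b)).toMonoidHom x ∈
          (Subgroup.zpowers θ).map (MulAut.conj (σ.gammaAction.conj b)).toMonoidHom :=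
        Subgroup.mem_map_of_mem _ hx
      rw [key] at this
      simpa using this
    · intro hx
      rw [← key] at hx
      obtain ⟨y, hy, hyx⟩ := hx
      have : y = x := by simpa using hyx
      rwa [← this]
  · rw [MonoidHom.map_zpowers] at key
    simpa using key

section

/-- A complex Lie algebra regarded as a real Lie algebra. -/
@[reducible]
def realLieAlgebra (L : Type*) [LieRing L] [LieAlgebra ℂ L] : LieAlgebra ℝ L where
  toModule := Module.complexToReal L
  lie_smul t x y := lie_smul (t : ℂ) x y

attribute [local instance] realLieAlgebra

/-- The real Lie algebra of fixed points of a conjugation. -/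
def realForm (σ : LieConjugation L) : LieSubalgebra ℝ L where
  carrier := {x | σ.toMap x = x}
  add_mem' := by
    intro a b ha hb
    simp only [Set.mem_ofPred_eq] at *
    rw [map_add, ha, hb]
  zero_mem' := by simp
  smul_mem' := by
    intro c x hx
    simp only [Set.mem_ofPred_eq] at *
    change σ.toMap ((c : ℂ) • x) = (c : ℂ) • x
    rw [map_smulₛₗ, hx, Complex.conj_ofReal]
  lie_mem' := by
    intro a b ha hb
    change σ.toMap ⁅a, b⁆ = ⁅a, b⁆
    rw [σ.map_lie]
    exact congrArg₂ _ ha hb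

/-- The real forms with conjugations `τ` and `σ` are isomorphic as real Lie algebras. -/
def Isomorphic (τ σ : LieConjugation L) : Prop :=
  Nonempty (τ.realForm ≃ₗ⁅ℝ⁆ σ.realForm)

/-- The real forms with conjugations `τ` and `τ'` are isomorphic as real Lie algebras, by an
isomorphism whose complex linear extension to an automorphism of `L` belongs to `N`. -/
def IsomorphicVia (N : Subgroup (L ≃ₗ⁅ℂ⁆ L)) (τ τ' : LieConjugation L) : Prop :=
  ∃ φ : τ.realForm ≃ₗ⁅ℝ⁆ τ'.realForm, ∃ Φ ∈ N, ∀ x : τ.realForm, Φ (x : L) = (φ x : L)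

theorem IsomorphicVia.refl (N : Subgroup (L ≃ₗ⁅ℂ⁆ L)) (τ : LieConjugation L) :
    IsomorphicVia N τ τ :=
  ⟨LieEquiv.refl, 1, N.one_mem, fun _ => rfl⟩

theorem IsomorphicVia.symm {N : Subgroup (L ≃ₗ⁅ℂ⁆ L)} {τ τ' : LieConjugation L}
    (h : IsomorphicVia N τ τ') : IsomorphicVia N τ' τ := by
  obtain ⟨φ, Φ, hΦ, h⟩ := h
  refine ⟨φ.symm, Φ⁻¹, N.inv_mem hΦ, fun x => ?_⟩
  have := h (φ.symm x)
  rw [LieEquiv.apply_symm_apply] at this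
  rw [← this]
  exact Φ.symm_apply_apply _

theorem IsomorphicVia.trans {N : Subgroup (L ≃ₗ⁅ℂ⁆ L)} {τ τ' τ'' : LieConjugation L}
    (h : IsomorphicVia N τ τ') (k : IsomorphicVia N τ' τ'') : IsomorphicVia N τ τ'' := by
  obtain ⟨φ, Φ, hΦ, h⟩ := h
  obtain ⟨ψ, Ψ, hΨ, k⟩ := k
  refine ⟨φ.trans ψ, Ψ * Φ, N.mul_mem hΨ hΦ, fun x => ?_⟩
  change Ψ (Φ x) = _
  rw [h, k]
  rfl

end

end LieConjugation

section

variable {L : Type*} [LieRing L] [LieAlgebra ℂ L]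

/-- The real forms of `(L, θ)` of type `σ`: the real forms of `L` over which the cyclic group `⟨θ⟩`
is defined, and whose underlying real Lie algebra is isomorphic to the one given by `σ`. -/
structure GradedRealForm (σ : LieConjugation L) (θ : L ≃ₗ⁅ℂ⁆ L) where
  /-- the conjugation with respect to the real form -/
  conjugation : LieConjugation L
  preserves : conjugation.Preserves (Subgroup.zpowers θ)
  isomorphic : conjugation.Isomorphic σ

/-- Isomorphism of real forms of `(L, θ)`: an isomorphism of real Lie algebras whose complexification
is an automorphism of `(L, ⟨θ⟩)`. -/
def GradedRealForm.setoid (σ : LieConjugation L) (θ : L ≃ₗ⁅ℂ⁆ L) :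
    Setoid (GradedRealForm σ θ) where
  r τ τ' := LieConjugation.IsomorphicVia (starNormalizer θ) τ.conjugation τ'.conjugation
  iseqv :=
    { refl := fun _ => LieConjugation.IsomorphicVia.refl _ _
      symm := fun h => h.symm
      trans := fun h k => h.trans k }

/-- The real points of the orbit `Y = Aut(L)·⟨θ⟩` of `⟨θ⟩` under conjugation. -/
def RealPoint (σ : LieConjugation L) (θ : L ≃ₗ⁅ℂ⁆ L) : Type _ :=
  {H : Subgroup (L ≃ₗ⁅ℂ⁆ L) //
    (∃ g, H = (Subgroup.zpowers θ).map (MulAut.conj g).toMonoidHom) ∧ σ.Preserves H}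

/-- Two real points are equivalent if they are conjugate under the automorphisms of the real form,
i.e. under the automorphisms of `L` which are fixed by `γ`. -/
def RealPoint.setoid (σ : LieConjugation L) (θ : L ≃ₗ⁅ℂ⁆ L) : Setoid (RealPoint σ θ) where
  r P Q := ∃ a, σ.gammaAction.conj a = a ∧ Q.1 = P.1.map (MulAut.conj a).toMonoidHom
  iseqv :=
    { refl := fun P => ⟨1, map_one _, by
        have : (MulAut.conj (1 : L ≃ₗ⁅ℂ⁆ L)).toMonoidHom = MonoidHom.id _ := by
          ext1 x
          simp
        rw [this, Subgroup.map_id]⟩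
      symm := by
        rintro P Q ⟨a, ha, h⟩
        refine ⟨a⁻¹, by rw [map_inv, ha], ?_⟩
        have : (MulAut.conj a⁻¹).toMonoidHom.comp (MulAut.conj a).toMonoidHom =
            MonoidHom.id _ := by
          ext1 x
          simp [mul_assoc]
        rw [h, Subgroup.map_map, this, Subgroup.map_id]
      trans := by
        rintro P Q R ⟨a, ha, h⟩ ⟨b, hb, k⟩
        refine ⟨b * a, by rw [map_mul, ha, hb], ?_⟩
        have : (MulAut.conj b).toMonoidHom.comp (MulAut.conj a).toMonoidHom =
            (MulAut.conj (b * a)).toMonoidHom := by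
          ext1 x
          simp
        rw [k, h, Subgroup.map_map, this] }

end

/-!
Put `A = Aut L` and `N = N*(⟨θ⟩)`, which is the full normalizer of `⟨θ⟩`, and let `W` be the set of
all `g` in `A` with `g⁻¹ γ(g) ∈ N`. All three sets of the theorem are the double cosets
`A^Γ \ W / N`. Indeed, `g⟨θ⟩g⁻¹` is a real point, and `g⁻¹ σ g` preserves `⟨θ⟩`, exactly when
`g ∈ W`; every real form of `L` isomorphic to the one of `σ` has conjugation `g⁻¹ σ g` for some `g`,
because an isomorphism of real forms extends complex linearly; and every class of the kernel is
represented by some `g⁻¹ γ(g) = (g⁻¹ σ g) σ`. So there are surjections from `W` onto the three sets,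
and their fibres are the double cosets.
-/

theorem exists_equiv_of_surjective {W X Y : Type*} {p : W → X} {f : W → Y}
    (hp : Function.Surjective p) (hf : Function.Surjective f)
    (h : ∀ w w', p w = p w' ↔ f w = f w') : ∃ F : X ≃ Y, ∀ w, F (p w) = f w := by
  let F : X ≃ Y := (Setoid.quotientKerEquivOfSurjective p hp).symm.trans
    ((Quotient.congrRight h).trans (Setoid.quotientKerEquivOfSurjective f hf))
  refine ⟨F, fun w => ?_⟩
  have hw : (Setoid.quotientKerEquivOfSurjective p hp).symm (p w) = Quotient.mk _ w :=
    (Equiv.symm_apply_eq _).2 rfl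
  simp only [F, Equiv.trans_apply, hw]
  rfl

section

variable {A : Type*} [Group A] (H : Subgroup A)

theorem map_conj_mul (a b : A) :
    H.map (MulAut.conj (a * b)).toMonoidHom =
      (H.map (MulAut.conj b).toMonoidHom).map (MulAut.conj a).toMonoidHom := by
  open Pointwise in
  rw [map_mul]
  exact mul_smul (MulAut.conj a) (MulAut.conj b) H

variable {H} in
theorem map_conj_eq_map_conj_iff {g h : A} :
    H.map (MulAut.conj g).toMonoidHom = H.map (MulAut.conj h).toMonoidHom ↔
      g⁻¹ * h ∈ Subgroup.normalizer (H : Set A) := by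
  open Pointwise in
  have inv_smul : (MulAut.conj g)⁻¹ • (MulAut.conj h • H) = MulAut.conj (g⁻¹ * h) • H := by
    rw [map_mul, map_inv, mul_smul]
  rw [Subgroup.mem_normalizer_iff_map_conj_eq, eq_comm]
  exact inv_smul_eq_iff.symm.trans (by rw [inv_smul])

theorem map_map_conj {A' : Type*} [Group A'] (f : A →* A') (g : A) :
    (H.map (MulAut.conj g).toMonoidHom).map f =
      (H.map f).map (MulAut.conj (f g)).toMonoidHom := by
  rw [Subgroup.map_map, Subgroup.map_map]
  congr 1
  ext1 x
  simp

theorem mem_starNormalizer_iff {θ g : A} :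
    g ∈ starNormalizer θ ↔ g ∈ Subgroup.normalizer (Subgroup.zpowers θ : Set A) := by
  refine ⟨fun hg => hg.1, fun hg => ⟨hg, ?_⟩⟩
  rw [← Subgroup.mem_normalizer_iff_map_conj_eq.1 hg, MonoidHom.map_zpowers]
  simp

end

namespace GammaAction

variable {A : Type*} [Group A] (s : GammaAction A)

/-- The group `A^Γ` of elements fixed by `Γ`. -/
def fixedSubgroup : Subgroup A := s.conj.eqLocus (MonoidHom.id A)

variable (B : Subgroup A)

/-- The elements `g` for which the coset `gB` is fixed by `Γ`, where `B` is a `Γ`-stable subgroup: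
this means that `γ(g)B = gB`. -/
def fixedCosetReps : Set A := {g | g⁻¹ * s.conj g ∈ B}

variable {B} (hB : ∀ b ∈ B, s.conj b ∈ B)

/-- The cocycle `g⁻¹ * γ(g)` of `B` attached to a `Γ`-fixed coset `gB`. -/
def connectingCocycle (g : s.fixedCosetReps B) : (s.restrict B hB).Cocycle :=
  ⟨⟨(g : A)⁻¹ * s.conj g, g.2⟩, Subtype.ext (by
    change (g : A)⁻¹ * s.conj g * s.conj ((g : A)⁻¹ * s.conj g) = 1
    rw [map_mul, map_inv, s.conj_conj]
    group)⟩

variable {s hB} in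
theorem H1.mk_mem_kernel_iff {z : (s.restrict B hB).Cocycle} :
    H1.mk _ z ∈ H1.kernel s B hB ↔ ∃ g : s.fixedCosetReps B, s.connectingCocycle hB g = z := by
  have coboundary_iff : H1.mk _ z ∈ H1.kernel s B hB ↔ ∃ g, (z.1 : A) = g⁻¹ * 1 * s.conj g :=
    eq_comm.trans (Quotient.eq (r := s.cohomologous))
  simp only [coboundary_iff, mul_one]
  constructor
  · rintro ⟨g, hg⟩
    exact ⟨⟨g, Set.mem_ofPred_eq.mpr (hg ▸ z.1.2)⟩, Subtype.ext (Subtype.ext hg.symm)⟩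
  · rintro ⟨g, rfl⟩
    exact ⟨g, rfl⟩

/-- The connecting map `(A/B)^Γ → ker [H¹(Γ, B) → H¹(Γ, A)]`, on representatives of cosets. -/
def connectingMap (g : s.fixedCosetReps B) : H1.kernel s B hB :=
  ⟨H1.mk _ (s.connectingCocycle hB g), H1.mk_mem_kernel_iff.2 ⟨g, rfl⟩⟩

theorem connectingMap_surjective : Function.Surjective (s.connectingMap hB) := by
  rintro ⟨x, hx⟩
  obtain ⟨z, rfl⟩ := Quotient.exists_rep x
  obtain ⟨g, rfl⟩ := H1.mk_mem_kernel_iff.1 hx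
  exact ⟨g, rfl⟩

theorem connectingMap_eq_iff (g h : s.fixedCosetReps B) :
    s.connectingMap hB g = s.connectingMap hB h ↔
      DoubleCoset.setoid (s.fixedSubgroup : Set A) B g h := by
  have cohomologous_iff : s.connectingMap hB g = s.connectingMap hB h ↔
      ∃ c : B, (h : A)⁻¹ * s.conj h = (c : A)⁻¹ * ((g : A)⁻¹ * s.conj g) * s.conj c :=
    Subtype.ext_iff.trans ((Quotient.eq (r := (s.restrict B hB).cohomologous)).trans
      (exists_congr fun _ => Subtype.ext_iff))
  rw [cohomologous_iff, DoubleCoset.rel_iff]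
  constructor
  · rintro ⟨c, hc⟩
    refine ⟨(h : A) * ((g : A) * (c : A))⁻¹, ?_, c, c.2, by group⟩
    change s.conj ((h : A) * ((g : A) * (c : A))⁻¹) = (h : A) * ((g : A) * (c : A))⁻¹
    rw [inv_mul_eq_iff_eq_mul] at hc
    rw [map_mul, map_inv, map_mul, hc]
    group
  · rintro ⟨a, ha, c, hc, h_eq⟩
    refine ⟨⟨c, hc⟩, ?_⟩
    have ha : s.conj a = a := ha
    simp only [h_eq, map_mul, ha]
    group

end GammaAction

namespace LieConjugation

variable {L : Type*} [LieRing L] [LieAlgebra ℂ L]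

section Complexification

attribute [local instance] realLieAlgebra

theorem toMap_coe (τ : LieConjugation L) (a : τ.realForm) : τ.toMap (a : L) = a :=
  a.2

/-- The decomposition `L = 𝔤 ⊕ i𝔤` of a complex Lie algebra with real form `𝔤`. -/
noncomputable def reImEquiv (τ : LieConjugation L) : (τ.realForm × τ.realForm) ≃ₗ[ℝ] L where
  toFun p := (p.1 : L) + Complex.I • (p.2 : L)
  map_add' p q := by
    simp only [Prod.fst_add, Prod.snd_add, AddMemClass.coe_add]
    module
  map_smul' r p := by
    simp only [Prod.smul_fst, Prod.smul_snd, SetLike.val_smul, RingHom.id_apply, smul_add,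
      smul_comm r]
  invFun x :=
    (⟨(2⁻¹ : ℂ) • (x + τ.toMap x), by
      change τ.toMap _ = _
      simp only [map_smulₛₗ, map_add, τ.involutive, map_inv₀, map_ofNat]
      module⟩,
    ⟨(2⁻¹ * -Complex.I) • (x - τ.toMap x), by
      change τ.toMap _ = _
      simp only [map_smulₛₗ, map_sub, τ.involutive, map_mul, map_neg, Complex.conj_I, map_inv₀,
        map_ofNat]
      module⟩)
  left_inv p := by
    ext
    · simp only [map_add, map_smulₛₗ, toMap_coe, Complex.conj_I]
      module
    · simp only [map_add, map_smulₛₗ, toMap_coe, Complex.conj_I]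
      match_scalars
      · ring
      · linear_combination (-1 : ℂ) * Complex.I_mul_I
  right_inv x := by
    dsimp only
    match_scalars
    · linear_combination (-1 / 2 : ℂ) * Complex.I_mul_I
    · linear_combination (1 / 2 : ℂ) * Complex.I_mul_I

theorem reImEquiv_apply (τ : LieConjugation L) (p : τ.realForm × τ.realForm) :
    τ.reImEquiv p = (p.1 : L) + Complex.I • (p.2 : L) :=
  rfl

theorem toMap_reImEquiv (τ : LieConjugation L) (p : τ.realForm × τ.realForm) :
    τ.toMap (τ.reImEquiv p) = τ.reImEquiv (p.1, -p.2) := by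
  simp [reImEquiv_apply, map_smulₛₗ, toMap_coe]

theorem smul_reImEquiv (τ : LieConjugation L) (z : ℂ) (p : τ.realForm × τ.realForm) :
    z • τ.reImEquiv p =
      τ.reImEquiv (z.re • p.1 - z.im • p.2, z.im • p.1 + z.re • p.2) := by
  have coe_smul (r : ℝ) (a : τ.realForm) : ((r • a : τ.realForm) : L) = (r : ℂ) • (a : L) := rfl
  simp only [reImEquiv_apply, AddSubgroupClass.coe_sub, AddMemClass.coe_add, coe_smul]
  nth_rewrite 1 [← Complex.re_add_im z]
  match_scalars
  · ring
  · linear_combination (z.im : ℂ) * Complex.I_mul_I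

theorem lie_reImEquiv (τ : LieConjugation L) (p q : τ.realForm × τ.realForm) :
    ⁅τ.reImEquiv p, τ.reImEquiv q⁆ =
      τ.reImEquiv (⁅p.1, q.1⁆ - ⁅p.2, q.2⁆, ⁅p.1, q.2⁆ + ⁅p.2, q.1⁆) := by
  simp only [reImEquiv_apply, lie_add, add_lie, lie_smul, smul_lie, AddMemClass.coe_add,
    AddSubgroupClass.coe_sub, LieSubalgebra.coe_bracket]
  match_scalars <;> simp

variable {L' : Type*} [LieRing L'] [LieAlgebra ℂ L']
  {τ : LieConjugation L} {τ' : LieConjugation L'} (φ : τ.realForm ≃ₗ⁅ℝ⁆ τ'.realForm)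

/-- The complex linear extension of an isomorphism of real forms, as a real linear map. -/
noncomputable def complexifyLinear : L ≃ₗ[ℝ] L' :=
  τ.reImEquiv.symm ≪≫ₗ φ.toLinearEquiv.prodCongr φ.toLinearEquiv ≪≫ₗ τ'.reImEquiv

theorem complexifyLinear_reImEquiv (p : τ.realForm × τ.realForm) :
    complexifyLinear φ (τ.reImEquiv p) = τ'.reImEquiv (φ p.1, φ p.2) := by
  simp [complexifyLinear]

/-- The complex linear extension of an isomorphism of real forms. -/
noncomputable def complexify : L ≃ₗ⁅ℂ⁆ L' where
  __ := complexifyLinear φ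
  map_smul' z x := by
    obtain ⟨p, rfl⟩ := τ.reImEquiv.surjective x
    change complexifyLinear φ _ = z • complexifyLinear φ _
    simp only [smul_reImEquiv, complexifyLinear_reImEquiv, map_add, map_sub, map_smul]
  map_lie' {x y} := by
    obtain ⟨p, rfl⟩ := τ.reImEquiv.surjective x
    obtain ⟨q, rfl⟩ := τ.reImEquiv.surjective y
    change complexifyLinear φ _ = ⁅complexifyLinear φ _, complexifyLinear φ _⁆
    simp only [lie_reImEquiv, complexifyLinear_reImEquiv, map_add, map_sub, LieEquiv.map_lie]

theorem complexify_coe (a : τ.realForm) : complexify φ (a : L) = φ a := by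
  change complexifyLinear φ a = φ a
  simpa [reImEquiv_apply] using complexifyLinear_reImEquiv φ (a, 0)

end Complexification

/-- The conjugation `g⁻¹ σ g`, whose real form is the preimage under `g` of the real form of `σ`. -/
def pullback (σ : LieConjugation L) (g : L ≃ₗ⁅ℂ⁆ L) : LieConjugation L where
  toMap :=
    { toFun x := g.symm (σ.toMap (g x))
      map_add' x y := by simp only [map_add]
      map_smul' c x := by simp only [map_smul, map_smulₛₗ] }
  map_lie x y := by
    change g.symm _ = ⁅g.symm _, g.symm _⁆
    rw [LieEquiv.map_lie, σ.map_lie, LieEquiv.map_lie]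
  involutive x := by
    change g.symm (σ.toMap (g (g.symm (σ.toMap (g x))))) = x
    rw [g.apply_symm_apply, σ.involutive, g.symm_apply_apply]

theorem toMap_injective : Function.Injective (toMap : LieConjugation L → _) := by
  rintro ⟨f, _, _⟩ ⟨f', _, _⟩ rfl
  rfl

theorem eq_pullback_iff {τ σ : LieConjugation L} {g : L ≃ₗ⁅ℂ⁆ L} :
    τ = σ.pullback g ↔ ∀ x, g (τ.toMap x) = σ.toMap (g x) := by
  constructor
  · rintro rfl x
    exact g.apply_symm_apply _
  · intro h
    refine toMap_injective (LinearMap.ext fun x => ?_)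
    change _ = g.symm _
    rw [← h, g.symm_apply_apply]

theorem pullback_pullback (σ : LieConjugation L) (g h : L ≃ₗ⁅ℂ⁆ L) :
    (σ.pullback g).pullback h = σ.pullback (g * h) :=
  rfl

theorem mem_fixedSubgroup_iff {σ : LieConjugation L} {a : L ≃ₗ⁅ℂ⁆ L} :
    a ∈ σ.gammaAction.fixedSubgroup ↔ ∀ x, a (σ.toMap x) = σ.toMap (a x) := by
  have fixed_iff : a ∈ σ.gammaAction.fixedSubgroup ↔ ∀ x, σ.toMap (a (σ.toMap x)) = a x :=
    LieEquiv.ext_iff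
  rw [fixed_iff]
  refine forall_congr' fun x => ⟨fun h => ?_, fun h => ?_⟩
  · rw [← h, σ.involutive]
  · rw [h, σ.involutive]

theorem pullback_eq_pullback_iff {σ : LieConjugation L} {g h : L ≃ₗ⁅ℂ⁆ L} :
    σ.pullback g = σ.pullback h ↔ h * g⁻¹ ∈ σ.gammaAction.fixedSubgroup := by
  rw [eq_pullback_iff, mem_fixedSubgroup_iff]
  refine (forall_congr' fun x => ?_).trans g.surjective.forall.symm
  change _ ↔ h (g.symm (σ.toMap (g x))) = σ.toMap (h (g.symm (g x)))
  rw [g.symm_apply_apply]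
  rfl

section RealForms

attribute [local instance] realLieAlgebra

/-- The isomorphism `x ↦ g x` of the real form of `g⁻¹ σ g` with that of `σ`. -/
def pullbackRealFormEquiv (σ : LieConjugation L) (g : L ≃ₗ⁅ℂ⁆ L) :
    (σ.pullback g).realForm ≃ₗ⁅ℝ⁆ σ.realForm where
  toFun x := ⟨g x, by
    exact (eq_pullback_iff.1 rfl (x : L)).symm.trans (congrArg g x.2)⟩
  map_add' x y := Subtype.ext (map_add g (x : L) y)
  map_smul' r x := Subtype.ext (map_smul g (r : ℂ) (x : L))
  map_lie' {x y} := Subtype.ext (g.map_lie (x : L) y)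
  invFun y := ⟨g.symm y, by
    change g.symm (σ.toMap (g (g.symm y))) = g.symm y
    rw [g.apply_symm_apply, toMap_coe]⟩
  left_inv x := Subtype.ext (g.symm_apply_apply (x : L))
  right_inv y := Subtype.ext (g.apply_symm_apply (y : L))

theorem isomorphicVia_iff {N : Subgroup (L ≃ₗ⁅ℂ⁆ L)} {τ τ' : LieConjugation L} :
    IsomorphicVia N τ τ' ↔ ∃ g ∈ N, τ = τ'.pullback g := by
  constructor
  · rintro ⟨φ, g, hg, hφ⟩
    have extends_φ (p : τ.realForm × τ.realForm) :
        g (τ.reImEquiv p) = τ'.reImEquiv (φ p.1, φ p.2) := by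
      simp only [reImEquiv_apply, map_add, map_smul, hφ]
    refine ⟨g, hg, eq_pullback_iff.2 fun x => ?_⟩
    obtain ⟨p, rfl⟩ := τ.reImEquiv.surjective x
    simp only [toMap_reImEquiv, extends_φ, map_neg]
  · rintro ⟨g, hg, rfl⟩
    exact ⟨τ'.pullbackRealFormEquiv g, g, hg, fun _ => rfl⟩

theorem isomorphic_iff {τ σ : LieConjugation L} : Isomorphic τ σ ↔ ∃ g, τ = σ.pullback g := by
  constructor
  · rintro ⟨φ⟩
    obtain ⟨g, -, hg⟩ := isomorphicVia_iff.1
      ⟨φ, complexify φ, Subgroup.mem_top _, complexify_coe φ⟩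
    exact ⟨g, hg⟩
  · rintro ⟨g, rfl⟩
    exact ⟨σ.pullbackRealFormEquiv g⟩

end RealForms

theorem isomorphicVia_pullback_iff {σ : LieConjugation L} {N : Subgroup (L ≃ₗ⁅ℂ⁆ L)}
    {g h : L ≃ₗ⁅ℂ⁆ L} :
    IsomorphicVia N (σ.pullback g) (σ.pullback h) ↔
      DoubleCoset.setoid (σ.gammaAction.fixedSubgroup : Set (L ≃ₗ⁅ℂ⁆ L)) N g h := by
  simp only [isomorphicVia_iff, pullback_pullback, pullback_eq_pullback_iff, DoubleCoset.rel_iff]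
  constructor
  · rintro ⟨c, hc, hfix⟩
    exact ⟨h * c * g⁻¹, hfix, c⁻¹, N.inv_mem hc, by group⟩
  · rintro ⟨a, ha, c, hc, rfl⟩
    refine ⟨c⁻¹, N.inv_mem hc, ?_⟩
    convert ha using 1
    group

variable {σ : LieConjugation L} {H : Subgroup (L ≃ₗ⁅ℂ⁆ L)} {g : L ≃ₗ⁅ℂ⁆ L}

theorem pullback_gammaAction_conj (σ : LieConjugation L) (g : L ≃ₗ⁅ℂ⁆ L) :
    (σ.pullback g).gammaAction.conj =
      (MulAut.conj (g⁻¹ * σ.gammaAction.conj g)).toMonoidHom.comp σ.gammaAction.conj := by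
  ext a x
  change g.symm (σ.toMap (g (a (g.symm (σ.toMap (g x)))))) =
    g.symm (σ.toMap (g (σ.toMap (σ.toMap (a (σ.toMap (σ.toMap (g.symm (σ.toMap (g x))))))))))
  simp only [σ.involutive]

theorem preserves_pullback_iff (hH : σ.Preserves H) :
    (σ.pullback g).Preserves H ↔
      g⁻¹ * σ.gammaAction.conj g ∈ Subgroup.normalizer (H : Set (L ≃ₗ⁅ℂ⁆ L)) := by
  rw [Preserves, pullback_gammaAction_conj, ← Subgroup.map_map, hH,
    Subgroup.mem_normalizer_iff_map_conj_eq]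
  rfl

theorem preserves_map_conj_iff (hH : σ.Preserves H) :
    σ.Preserves (H.map (MulAut.conj g).toMonoidHom) ↔
      g⁻¹ * σ.gammaAction.conj g ∈ Subgroup.normalizer (H : Set (L ≃ₗ⁅ℂ⁆ L)) := by
  rw [Preserves, map_map_conj, hH, eq_comm, map_conj_eq_map_conj_iff]

end LieConjugation

section

open LieConjugation

variable {L : Type*} [LieRing L] [LieAlgebra ℂ L] {σ : LieConjugation L} {θ : L ≃ₗ⁅ℂ⁆ L}
  (hσ : σ.Preserves (Subgroup.zpowers θ))

/-- The real form of `(L, θ)` with conjugation `g⁻¹ σ g`. -/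
def GradedRealForm.ofFixedCosetRep (g : σ.gammaAction.fixedCosetReps (starNormalizer θ)) :
    GradedRealForm σ θ where
  conjugation := σ.pullback g
  preserves := (preserves_pullback_iff hσ).2 (mem_starNormalizer_iff.1 g.2)
  isomorphic := isomorphic_iff.2 ⟨g, rfl⟩

theorem GradedRealForm.ofFixedCosetRep_surjective :
    Function.Surjective (GradedRealForm.ofFixedCosetRep hσ) := by
  rintro ⟨τ, hτ, hτσ⟩
  obtain ⟨g, rfl⟩ := isomorphic_iff.1 hτσ
  exact ⟨⟨g, mem_starNormalizer_iff.2 ((preserves_pullback_iff hσ).1 hτ)⟩, rfl⟩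

theorem GradedRealForm.ofFixedCosetRep_rel_iff
    (g h : σ.gammaAction.fixedCosetReps (starNormalizer θ)) :
    GradedRealForm.setoid σ θ (GradedRealForm.ofFixedCosetRep hσ g)
        (GradedRealForm.ofFixedCosetRep hσ h) ↔
      DoubleCoset.setoid (σ.gammaAction.fixedSubgroup : Set (L ≃ₗ⁅ℂ⁆ L)) (starNormalizer θ)
        g h :=
  isomorphicVia_pullback_iff

/-- The real point `g⟨θ⟩g⁻¹` of the orbit of `⟨θ⟩`. -/
def RealPoint.ofFixedCosetRep (g : σ.gammaAction.fixedCosetReps (starNormalizer θ)) :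
    RealPoint σ θ :=
  ⟨(Subgroup.zpowers θ).map (MulAut.conj (g : L ≃ₗ⁅ℂ⁆ L)).toMonoidHom, ⟨g, rfl⟩,
    (preserves_map_conj_iff hσ).2 (mem_starNormalizer_iff.1 g.2)⟩

theorem RealPoint.exists_ofFixedCosetRep_eq (P : RealPoint σ θ) {g : L ≃ₗ⁅ℂ⁆ L}
    (hg : P.1 = (Subgroup.zpowers θ).map (MulAut.conj g).toMonoidHom) :
    ∃ hg' : g ∈ σ.gammaAction.fixedCosetReps (starNormalizer θ),
      RealPoint.ofFixedCosetRep hσ ⟨g, hg'⟩ = P := by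
  refine ⟨mem_starNormalizer_iff.2 ((preserves_map_conj_iff hσ).1 ?_), Subtype.ext hg.symm⟩
  exact hg ▸ P.2.2

theorem RealPoint.ofFixedCosetRep_surjective :
    Function.Surjective (RealPoint.ofFixedCosetRep hσ) := by
  intro P
  obtain ⟨g, hg⟩ := P.2.1
  obtain ⟨hg', hP⟩ := P.exists_ofFixedCosetRep_eq hσ hg
  exact ⟨⟨g, hg'⟩, hP⟩

theorem RealPoint.ofFixedCosetRep_rel_iff
    (g h : σ.gammaAction.fixedCosetReps (starNormalizer θ)) :
    RealPoint.setoid σ θ (RealPoint.ofFixedCosetRep hσ g) (RealPoint.ofFixedCosetRep hσ h) ↔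
      DoubleCoset.setoid (σ.gammaAction.fixedSubgroup : Set (L ≃ₗ⁅ℂ⁆ L)) (starNormalizer θ)
        g h := by
  have conjugate_iff (a : L ≃ₗ⁅ℂ⁆ L) :
      (RealPoint.ofFixedCosetRep hσ h).1 =
          (RealPoint.ofFixedCosetRep hσ g).1.map (MulAut.conj a).toMonoidHom ↔
        (a * g)⁻¹ * h ∈ starNormalizer θ := by
    rw [mem_starNormalizer_iff, ← map_conj_eq_map_conj_iff, map_conj_mul, eq_comm]
    rfl
  change (∃ a, a ∈ σ.gammaAction.fixedSubgroup ∧ _) ↔ _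
  simp only [conjugate_iff, DoubleCoset.rel_iff]
  refine exists_congr fun a => and_congr_right fun _ => ⟨fun ha => ⟨_, ha, by group⟩, ?_⟩
  rintro ⟨c, hc, h_eq⟩
  rwa [h_eq, inv_mul_cancel_left]

end

open GammaAction in
theorem mainTheorem5_general {L : Type*} [LieRing L] [LieAlgebra ℂ L] (θ : L ≃ₗ⁅ℂ⁆ L)
    (σ : LieConjugation L) (hσ : σ.Preserves (Subgroup.zpowers θ)) :
    (∃ F : Quotient (GradedRealForm.setoid σ θ) ≃
        H1.kernel σ.gammaAction (starNormalizer θ) (σ.starNormalizer_stable hσ),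
      ∀ τ : GradedRealForm σ θ,
        ∃ z : (σ.gammaAction.restrict (starNormalizer θ) (σ.starNormalizer_stable hσ)).Cocycle,
          (∀ x, (z.1 : L ≃ₗ⁅ℂ⁆ L) x = τ.conjugation.toMap (σ.toMap x)) ∧
          (F (Quotient.mk _ τ)).1 = H1.mk _ z) ∧
    (∃ F : Quotient (RealPoint.setoid σ θ) ≃
        H1.kernel σ.gammaAction (starNormalizer θ) (σ.starNormalizer_stable hσ),
      ∀ P : RealPoint σ θ, ∀ g : L ≃ₗ⁅ℂ⁆ L,
        P.1 = (Subgroup.zpowers θ).map (MulAut.conj g).toMonoidHom →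
        ∃ z : (σ.gammaAction.restrict (starNormalizer θ) (σ.starNormalizer_stable hσ)).Cocycle,
          (z.1 : L ≃ₗ⁅ℂ⁆ L) = g⁻¹ * σ.gammaAction.conj g ∧
          (F (Quotient.mk _ P)).1 = H1.mk _ z) := by
  have connecting_surjective := σ.gammaAction.connectingMap_surjective
    (σ.starNormalizer_stable hσ)
  constructor
  · obtain ⟨F, hF⟩ := exists_equiv_of_surjective
      (Quotient.mk_surjective.comp (GradedRealForm.ofFixedCosetRep_surjective hσ))
      connecting_surjective fun g h => (Quotient.eq.trans
        (GradedRealForm.ofFixedCosetRep_rel_iff hσ g h)).trans (connectingMap_eq_iff _ _ g h).symm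
    refine ⟨F, fun τ => ?_⟩
    obtain ⟨g, rfl⟩ := GradedRealForm.ofFixedCosetRep_surjective hσ τ
    exact ⟨σ.gammaAction.connectingCocycle _ g, fun _ => rfl, congrArg Subtype.val (hF g)⟩
  · obtain ⟨F, hF⟩ := exists_equiv_of_surjective
      (Quotient.mk_surjective.comp (RealPoint.ofFixedCosetRep_surjective hσ))
      connecting_surjective fun g h => (Quotient.eq.trans
        (RealPoint.ofFixedCosetRep_rel_iff hσ g h)).trans (connectingMap_eq_iff _ _ g h).symm
    refine ⟨F, fun P g hg => ?_⟩
    obtain ⟨hg', rfl⟩ := P.exists_ofFixedCosetRep_eq hσ hg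
    exact ⟨σ.gammaAction.connectingCocycle _ ⟨g, hg'⟩, rfl, congrArg Subtype.val (hF _)⟩

open GammaAction in
theorem mainTheorem5 {L : Type*} [LieRing L] [LieAlgebra ℂ L] [FiniteDimensional ℂ L]
    (m : ℕ) (G : LieGrading m L) (hG : G.IsSimple)
    (θ : L ≃ₗ⁅ℂ⁆ L) (hθ : G.IsDefinedBy θ)
    (σ : LieConjugation L) (hσ : σ.Preserves (Subgroup.zpowers θ)) :
    (∃ F : Quotient (GradedRealForm.setoid σ θ) ≃
        H1.kernel σ.gammaAction (starNormalizer θ) (σ.starNormalizer_stable hσ),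
      ∀ τ : GradedRealForm σ θ,
        ∃ z : (σ.gammaAction.restrict (starNormalizer θ) (σ.starNormalizer_stable hσ)).Cocycle,
          (∀ x, (z.1 : L ≃ₗ⁅ℂ⁆ L) x = τ.conjugation.toMap (σ.toMap x)) ∧
          (F (Quotient.mk _ τ)).1 = H1.mk _ z) ∧
    (∃ F : Quotient (RealPoint.setoid σ θ) ≃
        H1.kernel σ.gammaAction (starNormalizer θ) (σ.starNormalizer_stable hσ),
      ∀ P : RealPoint σ θ, ∀ g : L ≃ₗ⁅ℂ⁆ L,
        P.1 = (Subgroup.zpowers θ).map (MulAut.conj g).toMonoidHom →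
        ∃ z : (σ.gammaAction.restrict (starNormalizer θ) (σ.starNormalizer_stable hσ)).Cocycle,
          (z.1 : L ≃ₗ⁅ℂ⁆ L) = g⁻¹ * σ.gammaAction.conj g ∧
          (F (Quotient.mk _ P)).1 = H1.mk _ z) :=
  mainTheorem5_general θ σ hσ
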